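/- **Conventions.** Boolean algebras may be degenerate ($0=1$ is allowed); $a^*$ denotes the complement of $a$. A *contact relation* on a Boolean algebra $A$ is a binary relation $C$ such that (C1) $a\neq 0$ implies $aCa$; (C2) $aCb$ implies $a\neq0$ and $b\neq 0$; (C3) $aCb$ implies $bCa$; (C4) $aC(b\vee c)$ iff $aCb$ or $aCc$. Write $a\ll_C b$ if not $aCb^*$. A *local contact algebra* (LCA) is a triple $(A,\rho,\mathbb B)$, where $A$ is a Boolean algebra, $\rho$ is a contact relation on $A$ and $\mathbb B$ is a (possibly non-proper) ideal of $A$, such that (BC1) if $a\in\mathbb B$, $c\in A$ and $a\ll_\rho c$, then $a\ll_\rho b\ll_\rho c$ for some $b\in\mathbb B$; (BC2) if $a\rho b$, then $a\rho(c\wedge b)$ for some $c\in\mathbb B$; (BC3) if $a\ne0$, then there is $b\in\mathbb B\setminus\{0\}$ with $b\ll_\rho a$. It is a *complete* LCA (CLCA) if $A$ is a complete Boolean algebra. A subset $S\subseteq\mathbb B$ is *dV-dense* in $(A,\rho,\mathbb B)$ if for all $a,c\in\mathbb B$ with $a\ll_\rho c$ there is $b\in S$ with $a\le b\le c$. An *LCA-embedding*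 $\varphi:(A,\rho,\mathbb B)\to(A',\rho',\mathbb B')$ is an injective Boolean homomorphism $\varphi:A\to A'$ such that, for all $a,b\in A$, $a\rho b$ iff $\varphi(a)\rho'\varphi(b)$, and $a\in\mathbb B$ iff $\varphi(a)\in\mathbb B'$; an *LCA-isomorphism* is a bijective LCA-embedding. An *LCA-completion* of an LCA $(A,\rho,\mathbb B)$ is a pair $(\varphi,(A',\rho',\mathbb B'))$, where $(A',\rho',\mathbb B')$ is a CLCA and $\varphi:(A,\rho,\mathbb B)\to(A',\rho',\mathbb B')$ is an LCA-embedding such that $\varphi(\mathbb B)$ is dV-dense in $(A',\rho',\mathbb B')$. Two LCA-completions $(\varphi,(A',\rho',\mathbb B'))$ and $(\psi,(A'',\rho'',\mathbb B''))$ of the same LCA are *equivalent* if there is an LCA-isomorphism $\theta:(A',\rho',\mathbb B')\to(A'',\rho'',\mathbb B'')$ with $\psi=\theta\circ\varphi$. A *cluster* of a contact relation $C$ on $A$ is a non-empty set $\sigma\subseteq A$ such that (K1) $aCb$ for all $a,b\in\sigma$; (K2) if $a\vee b\in\sigma$, then $a\in\sigma$ or $b\in\sigma$; (K3) if $aCb$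 for all $b\in\sigma$, then $a\in\sigma$. A *bounded cluster* of an LCA $(A,\rho,\mathbb B)$ is a cluster $\sigma$ of the relation $C_\rho$, given by: $a\,C_\rho\,b$ iff $a\rho b$ or $a,b\notin\mathbb B$, such that $\sigma\cap\mathbb B\ne\emptyset$. Let $\Psi^a(A,\rho,\mathbb B)$ be the set of all bounded clusters of $(A,\rho,\mathbb B)$ with the topology for which the sets $\{\sigma : a\in\sigma\}$, $a\in A$, form a base of closed sets. **Theorem.** Every local contact algebra $(A,\rho,\mathbb B)$ has an LCA-completion, and any two LCA-completions of $(A,\rho,\mathbb B)$ are equivalent. Moreover: 1. For every LCA $(A,\rho,\mathbb B)$ and every CLCA $(B,\eta,\mathbb B')$, the spaces $\Psi^a(A,\rho,\mathbb B)$ and $\Psi^a(B,\eta,\mathbb B')$ are homeomorphic if and only if there is an LCA-embedding $\varphi:(A,\rho,\mathbb B)\to(B,\eta,\mathbb B')$ such that $\varphi(\mathbb B)$ is dV-dense in $(B,\eta,\mathbb B')$. 2. For all LCAs $(A,\rho,\mathbb B)$ and $(A',\rho',\mathbb B')$, the spaces $\Psi^a(A,\rho,\mathbb B)$ and $\Psi^a(A',\rho',\mathbb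 B')$ are homeomorphic if and only if there are a CLCA $(B,\eta,\mathbb B'')$ and LCA-embeddings $\varphi:(A,\rho,\mathbb B)\to(B,\eta,\mathbb B'')$ and $\varphi':(A',\rho',\mathbb B')\to(B,\eta,\mathbb B'')$ such that $\varphi(\mathbb B)$ and $\varphi'(\mathbb B')$ are both dV-dense in $(B,\eta,\mathbb B'')$. -/

import Mathlib

universe u v w

/-- A contact relation on a Boolean algebra, i.e. a relation making it a contact algebra. -/
structure IsContact {A : Type u} [BooleanAlgebra A] (C : A → A → Prop) : Prop where
  refl_of_ne_bot : ∀ a : A, a ≠ ⊥ → C a a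
  ne_bot : ∀ a b : A, C a b → a ≠ ⊥ ∧ b ≠ ⊥
  symm : ∀ a b : A, C a b → C b a
  sup_iff : ∀ a b c : A, C a (b ⊔ c) ↔ C a b ∨ C a c

/-- The non-tangential inclusion `a ≪ b` of a relation `C`: `a` is not `C`-related to `bᶜ`. -/
def WayInside {A : Type u} [BooleanAlgebra A] (C : A → A → Prop) (a b : A) : Prop :=
  ¬ C a bᶜ

/-- The data turning a Boolean algebra `A` into a local contact algebra (LCA):
a contact relation `rel` and an ideal `bdd` of `A` (possibly all of `A`), the ideal of
bounded elements, with the axioms (BC1), (BC2) and (BC3). -/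
structure LocalContactAlgebra (A : Type u) [BooleanAlgebra A] where
  rel : A → A → Prop
  bdd : Order.Ideal A
  isContact : IsContact rel
  interpolate : ∀ a ∈ bdd, ∀ c : A, WayInside rel a c →
    ∃ b ∈ bdd, WayInside rel a b ∧ WayInside rel b c
  rel_local : ∀ a b : A, rel a b → ∃ c ∈ bdd, rel a (c ⊓ b)
  exists_inside : ∀ a : A, a ≠ ⊥ → ∃ b ∈ bdd, b ≠ ⊥ ∧ WayInside rel b a

namespace LocalContactAlgebra

/-- A dV-dense subset (a base) of an LCA: a set of bounded elements which interpolates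
between any two bounded elements `a ≪ c`. -/
def IsDVDense {A : Type u} [BooleanAlgebra A] (L : LocalContactAlgebra A) (S : Set A) : Prop :=
  S ⊆ (L.bdd : Set A) ∧
    ∀ a ∈ L.bdd, ∀ c ∈ L.bdd, WayInside L.rel a c → ∃ b ∈ S, a ≤ b ∧ b ≤ c

/-- LCA-embeddings: injective Boolean homomorphisms which preserve and reflect both the contact
relation and boundedness. (A bounded lattice homomorphism between Boolean algebras preserves
complements, so it is the same thing as a Boolean homomorphism.) -/
structure IsEmbedding {A : Type u} {B : Type v} [BooleanAlgebra A] [BooleanAlgebra B]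
    (L : LocalContactAlgebra A) (M : LocalContactAlgebra B) (φ : BoundedLatticeHom A B) :
    Prop where
  injective : Function.Injective φ
  rel_iff : ∀ a b : A, M.rel (φ a) (φ b) ↔ L.rel a b
  mem_bdd_iff : ∀ a : A, φ a ∈ M.bdd ↔ a ∈ L.bdd

/-- LCA-isomorphisms: Boolean isomorphisms (which are the same as order isomorphisms) which
preserve and reflect both the contact relation and boundedness. -/
structure IsIso {A : Type u} {B : Type v} [BooleanAlgebra A] [BooleanAlgebra B]
    (L : LocalContactAlgebra A) (M : LocalContactAlgebra B) (η : A ≃o B) : Prop where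
  rel_iff : ∀ a b : A, M.rel (η a) (η b) ↔ L.rel a b
  mem_bdd_iff : ∀ a : A, η a ∈ M.bdd ↔ a ∈ L.bdd

/-- `(φ, M)` is an LCA-completion of `L`: the Boolean algebra underlying `M` is complete, `φ` is
an LCA-embedding, and the image of the ideal of bounded elements of `L` is dV-dense in `M`. -/
structure IsCompletion {A : Type u} {B : Type v} [BooleanAlgebra A] [CompleteBooleanAlgebra B]
    (L : LocalContactAlgebra A) (M : LocalContactAlgebra B) (φ : BoundedLatticeHom A B) :
    Prop where
  isEmbedding : L.IsEmbedding M φ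
  isDVDense : M.IsDVDense (φ '' (L.bdd : Set A))

/-- The Alexandroff extension of the contact relation of an LCA: `a` and `b` are related if they
are in contact or if both are unbounded. -/
def alexandroffRel {A : Type u} [BooleanAlgebra A] (L : LocalContactAlgebra A) (a b : A) : Prop :=
  L.rel a b ∨ (a ∉ L.bdd ∧ b ∉ L.bdd)

end LocalContactAlgebra

/-- Clusters of a contact relation. -/
structure IsCluster {A : Type u} [BooleanAlgebra A] (C : A → A → Prop) (σ : Set A) : Prop where
  nonempty : σ.Nonempty
  rel_of_mem : ∀ a ∈ σ, ∀ b ∈ σ, C a b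
  mem_or_mem : ∀ a b : A, a ⊔ b ∈ σ → a ∈ σ ∨ b ∈ σ
  mem_of_forall_rel : ∀ a : A, (∀ b ∈ σ, C a b) → a ∈ σ

namespace LocalContactAlgebra

/-- The underlying set of the dual space of an LCA: its bounded clusters, i.e. the clusters of
the Alexandroff extension that contain a bounded element. -/
def DualSpace {A : Type u} [BooleanAlgebra A] (L : LocalContactAlgebra A) : Type u :=
  {σ : Set A // IsCluster L.alexandroffRel σ ∧ (σ ∩ (L.bdd : Set A)).Nonempty}

/-- The basic closed set of all bounded clusters containing `a`. -/
def basicClosed {A : Type u} [BooleanAlgebra A] (L : LocalContactAlgebra A) (a : A) :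
    Set L.DualSpace :=
  {σ | a ∈ σ.1}

/-- The topology of the dual space: the sets `L.basicClosed a` form a base of closed sets. -/
instance {A : Type u} [BooleanAlgebra A] (L : LocalContactAlgebra A) :
    TopologicalSpace L.DualSpace :=
  TopologicalSpace.generateFrom {U | ∃ a : A, U = (L.basicClosed a)ᶜ}

end LocalContactAlgebra

/-! The proof is a Stone-type duality. The dual space X of an LCA is locally compact Hausdorff, and
a ↦ interior of `basicClosed a` embeds the LCA into the regular open sets of X, where contact means
that closures meet and bounded means relatively compact. The images form a base of X, so a
compactness argument makes the bounded ones dV-dense; this is a completion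
(`isCompletion_representation`).

For uniqueness, dV-density implies order density, which determines the complete Boolean algebra up
to isomorphism over A (`HasOrderDenseImage.orderIso`). Boundedness and contact in a completion can
be expressed through the order and the image of A alone (`mem_bdd_iff`, `rel_iff`), so this
isomorphism respects them.

If the regular open sets of a locally compact Hausdorff X complete L, then x ↦ {a | x ∈ closure (φ
a)} is a homeomorphism from X onto the dual space of L (`nonempty_homeomorph`). Both statements
about homeomorphic dual spaces follow, because a complete LCA is its own completion and hence
isomorphic to the regular open sets of its dual space. -/

namespace IsContact

variable {A : Type u} [BooleanAlgebra A] {C : A → A → Prop}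

theorem mono_right (hC : IsContact C) {a b b' : A} (h : C a b) (hb : b ≤ b') : C a b' := by
  rw [← sup_eq_right.2 hb]
  exact (hC.sup_iff _ _ _).2 (Or.inl h)

theorem mono (hC : IsContact C) {a a' b b' : A} (h : C a b) (ha : a ≤ a') (hb : b ≤ b') :
    C a' b' :=
  hC.symm _ _ (hC.mono_right (hC.symm _ _ (hC.mono_right h hb)) ha)

theorem of_inf_ne_bot (hC : IsContact C) {a b : A} (h : a ⊓ b ≠ ⊥) : C a b :=
  hC.mono (hC.refl_of_ne_bot _ h) inf_le_left inf_le_right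

theorem wayInside_mono (hC : IsContact C) {a a' b b' : A} (h : WayInside C a b) (ha : a' ≤ a)
    (hb : b ≤ b') : WayInside C a' b' :=
  fun h' => h (hC.mono h' ha (compl_le_compl hb))

theorem le_of_wayInside (hC : IsContact C) {a b : A} (h : WayInside C a b) : a ≤ b := by
  by_contra hab
  exact h (hC.of_inf_ne_bot fun h0 => hab (by rwa [← disjoint_compl_right_iff, disjoint_iff]))

theorem wayInside_compl (hC : IsContact C) {a b : A} (h : WayInside C a b) :
    WayInside C bᶜ aᶜ := by
  intro h'
  rw [compl_compl] at h'
  exact h (hC.symm _ _ h')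

/-- The ideal of elements which are not in contact with `b`. -/
def nonContactIdeal (hC : IsContact C) (b : A) : Order.Ideal A :=
  Order.IsIdeal.toIdeal (I := {x | ¬ C b x})
    { IsLowerSet := fun _ _ hle hx h => hx (hC.mono_right h hle)
      Nonempty := ⟨⊥, fun h => (hC.ne_bot _ _ h).2 rfl⟩
      Directed := fun x hx y hy => ⟨x ⊔ y, fun h => ((hC.sup_iff _ _ _).1 h).elim hx hy,
        le_sup_left, le_sup_right⟩ }

end IsContact

/-! ### Clusters generated by prime ideals, and general facts on clusters. -/

section PrimeIdeal

variable {A : Type u} [BooleanAlgebra A]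

theorem Order.Ideal.exists_isPrime_le_notMem (I : Order.Ideal A) {a : A} (ha : a ∉ I) :
    ∃ J : Order.Ideal A, J.IsPrime ∧ I ≤ J ∧ a ∉ J := by
  obtain ⟨J, hJ, hIJ, hd⟩ := DistribLattice.prime_ideal_of_disjoint_filter_ideal
    (F := Order.PFilter.principal a) (I := I) (by
      rw [Set.disjoint_left]
      intro x hx hxI
      exact ha (I.lower (Order.PFilter.mem_principal.1 hx) hxI))
  exact ⟨J, hJ, hIJ, fun h => Set.disjoint_left.1 hd (Order.PFilter.mem_principal.2 le_rfl) h⟩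

theorem Order.Ideal.IsPrime.inf_notMem {J : Order.Ideal A} (hJ : J.IsPrime) {x y : A}
    (hx : x ∉ J) (hy : y ∉ J) : x ⊓ y ∉ J :=
  fun h => (hJ.mem_or_mem h).elim hx hy

variable {C : A → A → Prop}

/-- The set of all elements in contact with every member of the ultrafilter complementary to a
prime ideal. -/
def clusterOfPrime (C : A → A → Prop) (J : Order.Ideal A) : Set A :=
  {y | ∀ x ∉ J, C x y}

theorem mem_clusterOfPrime_of_notMem (hC : IsContact C) {J : Order.Ideal A} (hJ : J.IsPrime)
    {x : A} (hx : x ∉ J) : x ∈ clusterOfPrime C J := fun _ hy =>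
  hC.of_inf_ne_bot fun h => hJ.inf_notMem hy hx (h ▸ J.bot_mem)

/-- The hypothesis `hn` is needed only for (K1): if y and z were not in contact, an interpolant w
between y and zᶜ would exist, and whichever of w, wᶜ lies outside J contradicts membership of z or
y. -/
theorem isCluster_clusterOfPrime (hC : IsContact C)
    (hn : ∀ a c, WayInside C a c → ∃ b, WayInside C a b ∧ WayInside C b c)
    {J : Order.Ideal A} (hJ : J.IsPrime) : IsCluster C (clusterOfPrime C J) where
  nonempty := by
    have := hJ.toIsProper
    exact ⟨⊤, mem_clusterOfPrime_of_notMem hC hJ this.top_notMem⟩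
  rel_of_mem y hy z hz := by
    by_contra h
    obtain ⟨w, h₁, h₂⟩ := hn y zᶜ (by rwa [WayInside, compl_compl])
    by_cases hw : w ∈ J
    · have hw' : wᶜ ∉ J := fun h' =>
        hJ.toIsProper.top_notMem (by rw [← sup_compl_eq_top (x := w)]; exact J.sup_mem hw h')
      exact h₁ (hC.symm _ _ (hy _ hw'))
    · rw [WayInside, compl_compl] at h₂
      exact h₂ (hz _ hw)
  mem_or_mem y z hyz := by
    by_contra! h
    obtain ⟨h₁, h₂⟩ := h
    simp only [clusterOfPrime, Set.mem_ofPred_eq, not_forall] at h₁ h₂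
    obtain ⟨x, hx, hxy⟩ := h₁
    obtain ⟨x', hx', hxz⟩ := h₂
    rcases (hC.sup_iff _ _ _).1 (hyz _ (hJ.inf_notMem hx hx')) with h | h
    · exact hxy (hC.mono h inf_le_left le_rfl)
    · exact hxz (hC.mono h inf_le_right le_rfl)
  mem_of_forall_rel y hy x hx := hC.symm _ _ (hy x (mem_clusterOfPrime_of_notMem hC hJ hx))

end PrimeIdeal

namespace IsCluster

variable {A : Type u} [BooleanAlgebra A] {C : A → A → Prop} {σ τ : Set A}

theorem mem_of_le (hC : IsContact C) (hσ : IsCluster C σ) {a b : A} (ha : a ∈ σ) (h : a ≤ b) :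
    b ∈ σ :=
  hσ.mem_of_forall_rel _ fun c hc => hC.mono (hσ.rel_of_mem a ha c hc) h le_rfl

theorem sup_mem_iff (hC : IsContact C) (hσ : IsCluster C σ) {a b : A} :
    a ⊔ b ∈ σ ↔ a ∈ σ ∨ b ∈ σ :=
  ⟨hσ.mem_or_mem a b, fun h => h.elim (fun h => hσ.mem_of_le hC h le_sup_left)
    (fun h => hσ.mem_of_le hC h le_sup_right)⟩

theorem bot_notMem (hC : IsContact C) (hσ : IsCluster C σ) : ⊥ ∉ σ := fun h =>
  (hC.ne_bot _ _ (hσ.rel_of_mem _ h _ h)).1 rfl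

theorem mem_or_compl_mem (hC : IsContact C) (hσ : IsCluster C σ) (a : A) : a ∈ σ ∨ aᶜ ∈ σ := by
  obtain ⟨b, hb⟩ := hσ.nonempty
  exact hσ.mem_or_mem _ _ (hσ.mem_of_le hC hb (by simp))

theorem exists_not_rel (hσ : IsCluster C σ) {a : A} (ha : a ∉ σ) : ∃ b ∈ σ, ¬ C a b := by
  by_contra! h
  exact ha (hσ.mem_of_forall_rel a h)

/-- An element of τ is in contact with all of τ, hence with all of σ, so (K3) puts it in σ. -/
theorem eq_of_subset (hσ : IsCluster C σ) (hτ : IsCluster C τ) (h : σ ⊆ τ) : σ = τ :=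
  h.antisymm fun a ha => hσ.mem_of_forall_rel a fun b hb => hτ.rel_of_mem a ha b (h hb)

end IsCluster

/-! ### The Alexandroff extension and bounded clusters. -/

namespace LocalContactAlgebra

variable {A : Type u} [BooleanAlgebra A] (L : LocalContactAlgebra A)

theorem sup_mem_bdd_iff {a b : A} : a ⊔ b ∈ L.bdd ↔ a ∈ L.bdd ∧ b ∈ L.bdd :=
  ⟨fun h => ⟨L.bdd.lower le_sup_left h, L.bdd.lower le_sup_right h⟩,
    fun h => L.bdd.sup_mem h.1 h.2⟩

theorem exists_wayInside_of_mem_bdd {a : A} (ha : a ∈ L.bdd) :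
    ∃ b ∈ L.bdd, WayInside L.rel a b := by
  obtain ⟨b, hb, h, -⟩ := L.interpolate a ha ⊤ fun h =>
    (L.isContact.ne_bot _ _ h).2 compl_top
  exact ⟨b, hb, h⟩

theorem isContact_alexandroffRel : IsContact L.alexandroffRel where
  refl_of_ne_bot a ha := Or.inl (L.isContact.refl_of_ne_bot a ha)
  ne_bot a b h := by
    rcases h with h | ⟨h₁, h₂⟩
    · exact L.isContact.ne_bot a b h
    · exact ⟨fun h => h₁ (h ▸ L.bdd.bot_mem), fun h => h₂ (h ▸ L.bdd.bot_mem)⟩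
  symm a b h := h.imp (L.isContact.symm a b) And.symm
  sup_iff a b c := by
    simp only [alexandroffRel, L.isContact.sup_iff, L.sup_mem_bdd_iff]
    tauto

variable {L}

theorem alexandroffRel_iff_of_mem_bdd {a b : A} (ha : a ∈ L.bdd) :
    L.alexandroffRel a b ↔ L.rel a b := by
  simp [alexandroffRel, ha]

/-- For bounded a this is (BC1). For unbounded a, the complement of c must be bounded, so (BC1)
applies to cᶜ ≪ aᶜ and the interpolant is complemented. -/
theorem exists_between_of_wayInside_alexandroffRel (a c : A)
    (h : WayInside L.alexandroffRel a c) :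
    ∃ b, WayInside L.alexandroffRel a b ∧ WayInside L.alexandroffRel b c := by
  have key : ∀ a c : A, a ∈ L.bdd → WayInside L.alexandroffRel a c →
      ∃ b, WayInside L.alexandroffRel a b ∧ WayInside L.alexandroffRel b c := by
    intro a c ha h
    obtain ⟨b, hb, h₁, h₂⟩ := L.interpolate a ha c fun h' => h (Or.inl h')
    exact ⟨b, fun h' => h₁ ((alexandroffRel_iff_of_mem_bdd ha).1 h'),
      fun h' => h₂ ((alexandroffRel_iff_of_mem_bdd hb).1 h')⟩
  by_cases ha : a ∈ L.bdd
  · exact key a c ha h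
  · have hc : cᶜ ∈ L.bdd := by
      by_contra hc
      exact h (Or.inr ⟨ha, hc⟩)
    have hC := L.isContact_alexandroffRel
    obtain ⟨b, h₁, h₂⟩ := key _ _ hc (hC.wayInside_compl h)
    refine ⟨bᶜ, ?_, ?_⟩
    · simpa using hC.wayInside_compl h₂
    · simpa using hC.wayInside_compl h₁

namespace DualSpace

theorem isCluster (σ : L.DualSpace) : IsCluster L.alexandroffRel σ.1 := σ.2.1

theorem mem_of_le (σ : L.DualSpace) {a b : A} (ha : a ∈ σ.1) (h : a ≤ b) : b ∈ σ.1 :=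
  σ.isCluster.mem_of_le L.isContact_alexandroffRel ha h

theorem mem_or_compl_mem (σ : L.DualSpace) (a : A) : a ∈ σ.1 ∨ aᶜ ∈ σ.1 :=
  σ.isCluster.mem_or_compl_mem L.isContact_alexandroffRel a

/-- Topologically, σ is interior to `basicClosed d` with d bounded; this is the source of local
compactness. -/
theorem exists_mem_bdd_compl_notMem (σ : L.DualSpace) : ∃ d ∈ L.bdd, dᶜ ∉ σ.1 := by
  obtain ⟨c, hcσ, hc⟩ := σ.2.2
  obtain ⟨d, hd, h⟩ := L.exists_wayInside_of_mem_bdd hc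
  exact ⟨d, hd, fun h' =>
    h ((alexandroffRel_iff_of_mem_bdd hc).1 (σ.isCluster.rel_of_mem c hcσ _ h'))⟩

theorem exists_inf_mem_bdd (σ : L.DualSpace) {a : A} (ha : a ∈ σ.1) :
    ∃ d ∈ L.bdd, a ⊓ d ∈ σ.1 := by
  obtain ⟨d, hd, hdσ⟩ := σ.exists_mem_bdd_compl_notMem
  refine ⟨d, hd, ?_⟩
  rcases σ.isCluster.mem_or_mem (a ⊓ d) (a ⊓ dᶜ) (by rwa [← inf_sup_left, sup_compl_eq_top,
    inf_top_eq]) with h | h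
  · exact h
  · exact absurd (σ.mem_of_le h inf_le_right) hdσ

theorem rel_of_mem (σ : L.DualSpace) {a b : A} (ha : a ∈ σ.1) (hb : b ∈ σ.1) : L.rel a b := by
  obtain ⟨d, hd, h⟩ := σ.exists_inf_mem_bdd ha
  exact L.isContact.mono ((alexandroffRel_iff_of_mem_bdd (L.bdd.lower inf_le_right hd)).1
    (σ.isCluster.rel_of_mem _ h b hb)) inf_le_left le_rfl

end DualSpace

/-- The bounded cluster generated by a prime ideal that misses a bounded element. -/
def dualPoint (J : Order.Ideal A) (hJ : J.IsPrime) {a : A} (ha : a ∈ L.bdd) (haJ : a ∉ J) :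
    L.DualSpace :=
  ⟨clusterOfPrime L.alexandroffRel J, isCluster_clusterOfPrime L.isContact_alexandroffRel
    exists_between_of_wayInside_alexandroffRel hJ,
    a, mem_clusterOfPrime_of_notMem L.isContact_alexandroffRel hJ haJ, ha⟩

/-- By (BC2) some bounded c ⊓ a is in contact with b. A prime ideal containing everything not in
contact with b, but not c ⊓ a, generates the required cluster. -/
theorem exists_dualSpace_mem_mem {a b : A} (h : L.rel a b) :
    ∃ σ : L.DualSpace, a ∈ σ.1 ∧ b ∈ σ.1 := by
  obtain ⟨c, hc, hac⟩ := L.rel_local b a (L.isContact.symm _ _ h)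
  have hC := L.isContact_alexandroffRel
  obtain ⟨J, hJ, hIJ, hcJ⟩ := (hC.nonContactIdeal b).exists_isPrime_le_notMem (a := c ⊓ a)
    fun h' => h' (Or.inl hac)
  refine ⟨dualPoint J hJ (L.bdd.lower inf_le_left hc) hcJ,
    DualSpace.mem_of_le _ (mem_clusterOfPrime_of_notMem hC hJ hcJ) inf_le_right, fun x hx => ?_⟩
  by_contra h'
  exact hx (hIJ fun h'' => h' (hC.symm _ _ h''))

theorem exists_dualSpace_mem_compl_notMem {a : A} (h : a ≠ ⊥) :
    ∃ σ : L.DualSpace, a ∈ σ.1 ∧ aᶜ ∉ σ.1 := by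
  obtain ⟨e, -, he, hea⟩ := L.exists_inside a h
  obtain ⟨σ, hσ, -⟩ := exists_dualSpace_mem_mem (L.isContact.refl_of_ne_bot e he)
  exact ⟨σ, σ.mem_of_le hσ (L.isContact.le_of_wayInside hea), fun h' => hea (σ.rel_of_mem hσ h')⟩

/-! ### Topology of the dual space: regular closed base, Hausdorff, locally compact. -/

theorem basicClosed_sup (a b : A) :
    L.basicClosed (a ⊔ b) = L.basicClosed a ∪ L.basicClosed b :=
  Set.ext fun σ => σ.isCluster.sup_mem_iff L.isContact_alexandroffRel

theorem basicClosed_bot : L.basicClosed ⊥ = ∅ :=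
  Set.eq_empty_of_forall_notMem fun σ => σ.isCluster.bot_notMem L.isContact_alexandroffRel

theorem basicClosed_mono {a b : A} (h : a ≤ b) : L.basicClosed a ⊆ L.basicClosed b :=
  fun σ hσ => σ.mem_of_le hσ h

theorem basicClosed_subset_iff {a b : A} : L.basicClosed a ⊆ L.basicClosed b ↔ a ≤ b := by
  refine ⟨fun h => ?_, basicClosed_mono⟩
  by_contra hab
  have hne : a ⊓ bᶜ ≠ ⊥ := fun h0 => hab (by rwa [← disjoint_compl_right_iff, disjoint_iff])
  obtain ⟨σ, h₁, h₂⟩ := exists_dualSpace_mem_compl_notMem (L := L) hne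
  exact h₂ (σ.mem_of_le (h (σ.mem_of_le h₁ inf_le_left)) (by simp))

theorem basicClosed_inter_nonempty_iff {a b : A} :
    (L.basicClosed a ∩ L.basicClosed b).Nonempty ↔ L.rel a b :=
  ⟨fun ⟨σ, ha, hb⟩ => σ.rel_of_mem ha hb, exists_dualSpace_mem_mem⟩

theorem isClosed_basicClosed (a : A) : IsClosed (L.basicClosed a) :=
  ⟨TopologicalSpace.isOpen_generateFrom_of_mem ⟨a, rfl⟩⟩

theorem isTopologicalBasis_compl_basicClosed :
    TopologicalSpace.IsTopologicalBasis {U | ∃ a : A, U = (L.basicClosed a)ᶜ} where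
  exists_subset_inter := by
    rintro _ ⟨a, rfl⟩ _ ⟨b, rfl⟩ σ hσ
    refine ⟨_, ⟨a ⊔ b, rfl⟩, ?_, ?_⟩ <;> rw [basicClosed_sup, Set.compl_union]
    exact hσ
  sUnion_eq := by
    refine Set.eq_univ_of_forall fun σ => ⟨_, ⟨⊥, rfl⟩, ?_⟩
    rw [basicClosed_bot]
    exact id
  eq_generateFrom := rfl

/-- If a basic neighbourhood `(basicClosed b)ᶜ` meets `basicClosed a`, then a ⊓ bᶜ ≠ ⊥, and a point
avoiding aᶜ ⊔ b lies both in that neighbourhood and in `(basicClosed aᶜ)ᶜ`. -/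
theorem closure_compl_basicClosed_compl (a : A) :
    closure (L.basicClosed aᶜ)ᶜ = L.basicClosed a := by
  refine (closure_minimal (fun σ hσ => (σ.mem_or_compl_mem a).resolve_right hσ)
    (isClosed_basicClosed a)).antisymm fun σ hσ => ?_
  rw [isTopologicalBasis_compl_basicClosed.mem_closure_iff]
  rintro _ ⟨b, rfl⟩ hb
  have hne : a ⊓ bᶜ ≠ ⊥ := fun h0 => hb (σ.mem_of_le hσ (by
    rwa [← disjoint_compl_right_iff, disjoint_iff]))
  obtain ⟨τ, -, h⟩ := exists_dualSpace_mem_compl_notMem (L := L) hne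
  rw [compl_inf, compl_compl] at h
  exact ⟨τ, fun h' => h (τ.mem_of_le h' le_sup_right), fun h' => h (τ.mem_of_le h' le_sup_left)⟩

theorem interior_basicClosed (a : A) : interior (L.basicClosed a) = (L.basicClosed aᶜ)ᶜ := by
  rw [← closure_compl_basicClosed_compl aᶜ, compl_compl, interior_eq_compl_closure_compl]

instance : T2Space L.DualSpace where
  t2 σ τ hne := by
    obtain ⟨b, hbσ, hbτ⟩ : ∃ b ∈ σ.1, b ∉ τ.1 := by
      by_contra! h
      exact hne (Subtype.ext (σ.isCluster.eq_of_subset τ.isCluster h))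
    obtain ⟨c, hcτ, hbc⟩ := τ.isCluster.exists_not_rel hbτ
    obtain ⟨w, h₁, h₂⟩ := exists_between_of_wayInside_alexandroffRel b cᶜ
      (by rwa [WayInside, compl_compl])
    rw [WayInside, compl_compl] at h₂
    refine ⟨_, _, (isClosed_basicClosed wᶜ).isOpen_compl, (isClosed_basicClosed w).isOpen_compl,
      fun h => h₁ (σ.isCluster.rel_of_mem _ hbσ _ h),
      fun h => h₂ (τ.isCluster.rel_of_mem _ h _ hcτ), ?_⟩
    rw [Set.disjoint_left]
    intro υ h h'
    exact (υ.mem_or_compl_mem w).elim h' h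

theorem isCompact_basicClosed {a : A} (ha : a ∈ L.bdd) : IsCompact (L.basicClosed a) := by
  rw [isCompact_iff_ultrafilter_le_nhds']
  intro F hF
  have hC := L.isContact_alexandroffRel
  -- `basicClosed` preserves joins but not meets, so I is an ideal that need not be prime. Any prime
  -- J ⊇ I avoiding a yields a limit of F: if `basicClosed b` ∈ F, it meets `basicClosed x` for all
  -- x ∉ J, so b belongs to the cluster of J.
  let I : Order.Ideal A := Order.IsIdeal.toIdeal (I := {x | L.basicClosed x ∉ F})
    { IsLowerSet := fun _ _ hle hx h => hx (Filter.mem_of_superset h (basicClosed_mono hle))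
      Nonempty := ⟨⊥, by simp [basicClosed_bot]⟩
      Directed := fun x hx y hy => ⟨x ⊔ y, by
        simp only [Set.mem_ofPred_eq, basicClosed_sup, Ultrafilter.union_mem_iff]
        exact fun h => h.elim hx hy, le_sup_left, le_sup_right⟩ }
  have hI : ∀ x, x ∉ I ↔ L.basicClosed x ∈ F := fun x => not_not
  obtain ⟨J, hJ, hIJ, haJ⟩ := I.exists_isPrime_le_notMem (a := a) ((hI a).2 hF)
  refine ⟨dualPoint J hJ ha haJ, mem_clusterOfPrime_of_notMem hC hJ haJ, ?_⟩
  rw [isTopologicalBasis_compl_basicClosed.nhds_hasBasis.ge_iff]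
  rintro _ ⟨⟨b, rfl⟩, hb⟩
  refine Ultrafilter.compl_mem_iff_notMem.2 fun hbF => hb fun x hx => Or.inl ?_
  exact basicClosed_inter_nonempty_iff.1
    (F.nonempty_of_mem (Filter.inter_mem ((hI x).1 fun h => hx (hIJ h)) hbF))

theorem basicClosed_mem_nhds {σ : L.DualSpace} {d : A} (h : dᶜ ∉ σ.1) :
    L.basicClosed d ∈ nhds σ :=
  mem_interior_iff_mem_nhds.1 (by rw [interior_basicClosed]; exact h)

/-- Interiors of `basicClosed d` with d bounded cover the space, and bounded elements are closed
under joins, so a compact `basicClosed a` lies in a single one. -/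
theorem isCompact_basicClosed_iff {a : A} : IsCompact (L.basicClosed a) ↔ a ∈ L.bdd := by
  refine ⟨fun h => ?_, isCompact_basicClosed⟩
  obtain ⟨d, hd, h'⟩ : ∃ d ∈ L.bdd, L.basicClosed a ⊆ L.basicClosed d := by
    refine h.induction_on (p := fun s => ∃ d ∈ L.bdd, s ⊆ L.basicClosed d)
      ⟨⊥, L.bdd.bot_mem, Set.empty_subset _⟩
      (fun s t hst ⟨d, hd, h⟩ => ⟨d, hd, hst.trans h⟩)
      (fun s t ⟨d, hd, h⟩ ⟨e, he, h'⟩ => ⟨d ⊔ e, L.bdd.sup_mem hd he, ?_⟩) fun σ _ => ?_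
    · rw [basicClosed_sup]
      exact Set.union_subset_union h h'
    · obtain ⟨d, hd, h⟩ := σ.exists_mem_bdd_compl_notMem
      exact ⟨_, mem_nhdsWithin_of_mem_nhds (basicClosed_mem_nhds h), d, hd, subset_rfl⟩
  exact L.bdd.lower (basicClosed_subset_iff.1 h') hd

instance : WeaklyLocallyCompactSpace L.DualSpace where
  exists_compact_mem_nhds σ := by
    obtain ⟨d, hd, h⟩ := σ.exists_mem_bdd_compl_notMem
    exact ⟨_, isCompact_basicClosed hd, basicClosed_mem_nhds h⟩

end LocalContactAlgebra

/-! ### The complete LCA of regular open sets of a locally compact regular space. -/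

open TopologicalSpace

namespace Heyting.Regular

instance completeBooleanAlgebra {α : Type*} [Order.Frame α] :
    CompleteBooleanAlgebra (Regular α) where
  __ := (inferInstance : BooleanAlgebra (Regular α))
  sSup s := toRegular (sSup ((↑) '' s))
  sInf s := toRegular (sInf ((↑) '' s))
  isLUB_sSup _ := gi.isLUB_of_u_image (isLUB_sSup _)
  isGLB_sInf s := by
    have h := gi.choice_eq _ ((isGLB_sInf _).2 <|
      gi.gc.monotone_u.mem_lowerBounds_image (gi.isGLB_of_u_image <|
        isGLB_sInf (((↑) : Regular α → α) '' s)).1)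
    exact gi.isGLB_of_u_image (isGLB_sInf _)

end Heyting.Regular

/-- The complete Boolean algebra of regular open sets of a topological space. -/
def RegularOpens (X : Type u) [TopologicalSpace X] : Type u := Heyting.Regular (Opens X)

namespace RegularOpens

variable {X : Type u} [TopologicalSpace X]

instance : CompleteBooleanAlgebra (RegularOpens X) :=
  inferInstanceAs (CompleteBooleanAlgebra (Heyting.Regular (Opens X)))

/-- The underlying set of a regular open set. -/
def carrier (U : RegularOpens X) : Set X := ((Heyting.Regular.val U : Opens X) : Set X)

theorem isOpen_carrier (U : RegularOpens X) : IsOpen U.carrier := (Heyting.Regular.val U).isOpen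

theorem le_iff {U V : RegularOpens X} : U ≤ V ↔ U.carrier ⊆ V.carrier := Iff.rfl

theorem carrier_injective : Function.Injective (carrier (X := X)) := fun _ _ h =>
  le_antisymm (le_iff.2 h.subset) (le_iff.2 h.symm.subset)

theorem carrier_compl (U : RegularOpens X) : Uᶜ.carrier = (closure U.carrier)ᶜ := by
  rw [← interior_compl]
  exact Opens.coe_compl_eq_interior_compl

theorem interior_closure_carrier (U : RegularOpens X) :
    interior (closure U.carrier) = U.carrier := by
  conv_rhs => rw [← compl_compl U]
  rw [carrier_compl, carrier_compl, interior_eq_compl_closure_compl]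

theorem closure_carrier_compl (U : RegularOpens X) : closure Uᶜ.carrier = U.carrierᶜ := by
  rw [carrier_compl, closure_compl, interior_closure_carrier]

theorem carrier_inf (U V : RegularOpens X) : (U ⊓ V).carrier = U.carrier ∩ V.carrier := rfl

theorem carrier_bot : (⊥ : RegularOpens X).carrier = ∅ := rfl

theorem carrier_top : (⊤ : RegularOpens X).carrier = Set.univ := rfl

theorem closure_subset_closure_iff {U V : RegularOpens X} :
    closure U.carrier ⊆ closure V.carrier ↔ U ≤ V := by
  refine ⟨fun h => ?_, fun h => closure_mono h⟩
  rw [le_iff, ← interior_closure_carrier U, ← interior_closure_carrier V]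
  exact interior_mono h

/-- Closures turn joins into unions, while carriers turn meets into intersections; joins are
therefore always computed on closures. -/
theorem closure_carrier_sup (U V : RegularOpens X) :
    closure (U ⊔ V).carrier = closure U.carrier ∪ closure V.carrier := by
  have h : (U ⊔ V) = (Uᶜ ⊓ Vᶜ)ᶜ := by simp
  rw [h, closure_carrier_compl, carrier_inf, carrier_compl, carrier_compl, Set.compl_inter,
    compl_compl, compl_compl]

theorem closure_carrier_bot : closure (⊥ : RegularOpens X).carrier = ∅ := by
  rw [carrier_bot, closure_empty]

theorem eq_bot_iff_carrier {U : RegularOpens X} : U = ⊥ ↔ U.carrier = ∅ :=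
  ⟨fun h => h ▸ carrier_bot, fun h => carrier_injective (h.trans carrier_bot.symm)⟩

/-- The regular open set `interior F`, for a closed set `F`. -/
def ofIsClosed (F : Set X) (hF : IsClosed F) : RegularOpens X :=
  ⟨Opens.interior F, by
    apply Opens.ext
    rw [Opens.coe_compl_eq_interior_compl, Opens.coe_compl_eq_interior_compl, interior_compl,
      interior_compl, closure_compl, compl_compl, Opens.coe_interior]
    exact (interior_mono (closure_minimal interior_subset hF)).antisymm
      (interior_maximal subset_closure isOpen_interior)⟩

theorem carrier_ofIsClosed (F : Set X) (hF : IsClosed F) :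
    (ofIsClosed F hF).carrier = interior F := rfl

variable (X) in
theorem isContact : IsContact (fun U V : RegularOpens X =>
    (closure U.carrier ∩ closure V.carrier).Nonempty) where
  refl_of_ne_bot U hU := by
    rw [Set.inter_self, closure_nonempty_iff, Set.nonempty_iff_ne_empty]
    exact fun h => hU (eq_bot_iff_carrier.2 h)
  ne_bot U V h := by
    constructor <;> rintro rfl <;> simp [closure_carrier_bot] at h
  symm U V h := by rwa [Set.inter_comm]
  sup_iff U V W := by
    rw [closure_carrier_sup, Set.inter_union_distrib_left, Set.union_nonempty]

/-- The ideal of regular open sets with compact closure. -/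
def relativelyCompact (X : Type u) [TopologicalSpace X] : Order.Ideal (RegularOpens X) :=
  Order.IsIdeal.toIdeal (I := {U | IsCompact (closure U.carrier)})
    { IsLowerSet := fun _ _ hle h => h.of_isClosed_subset isClosed_closure (closure_mono hle)
      Nonempty := ⟨⊥, by simp [closure_carrier_bot]⟩
      Directed := fun U hU V hV => ⟨U ⊔ V, by
        simp only [Set.mem_ofPred_eq, closure_carrier_sup]
        exact hU.union hV, le_sup_left, le_sup_right⟩ }

theorem wayInside_iff {U V : RegularOpens X} :
    WayInside (fun U V : RegularOpens X => (closure U.carrier ∩ closure V.carrier).Nonempty) U V ↔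
      closure U.carrier ⊆ V.carrier := by
  rw [WayInside, closure_carrier_compl, Set.inter_compl_nonempty_iff, not_not]

/-- This yields (BC1) with K a compact closure, and (BC2) and (BC3) with K a point. -/
theorem exists_between [LocallyCompactSpace X] [RegularSpace X] {K O : Set X} (hK : IsCompact K)
    (hO : IsOpen O) (h : K ⊆ O) :
    ∃ U ∈ relativelyCompact X, K ⊆ U.carrier ∧ closure U.carrier ⊆ O := by
  obtain ⟨H, hH, hHc, hKH, hHO⟩ := exists_compact_closed_between hK hO h
  have hsub : closure (interior H) ⊆ H := closure_minimal interior_subset hHc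
  exact ⟨ofIsClosed H hHc, hH.of_isClosed_subset isClosed_closure hsub, hKH, hsub.trans hHO⟩

/-- The complete local contact algebra of regular open sets of a locally compact Hausdorff
space: regular open sets are in contact if their closures meet, and bounded if they are
relatively compact. -/
def localContactAlgebra (X : Type u) [TopologicalSpace X] [LocallyCompactSpace X]
    [RegularSpace X] :
    LocalContactAlgebra (RegularOpens X) where
  rel U V := (closure U.carrier ∩ closure V.carrier).Nonempty
  bdd := relativelyCompact X
  isContact := isContact X
  interpolate U hU V h := by
    rw [wayInside_iff] at h
    obtain ⟨W, hW, h₁, h₂⟩ := exists_between hU V.isOpen_carrier h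
    exact ⟨W, hW, wayInside_iff.2 h₁, wayInside_iff.2 h₂⟩
  rel_local U V := by
    rintro ⟨x, hxU, hxV⟩
    obtain ⟨W, hW, h, -⟩ := exists_between (isCompact_singleton (x := x)) isOpen_univ
      (Set.subset_univ _)
    refine ⟨W, hW, x, hxU, ?_⟩
    exact W.isOpen_carrier.inter_closure ⟨h rfl, hxV⟩
  exists_inside U hU := by
    rw [Ne, eq_bot_iff_carrier, ← Ne, ← Set.nonempty_iff_ne_empty] at hU
    obtain ⟨x, hx⟩ := hU
    obtain ⟨W, hW, h₁, h₂⟩ := exists_between (isCompact_singleton (x := x)) U.isOpen_carrier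
      (Set.singleton_subset_iff.2 hx)
    refine ⟨W, hW, ?_, wayInside_iff.2 h₂⟩
    rintro rfl
    exact h₁ rfl

end RegularOpens

namespace RegularOpens

variable {X : Type u} [TopologicalSpace X]

theorem closure_carrier_injective :
    Function.Injective (fun U : RegularOpens X => closure U.carrier) := fun _ _ h =>
  le_antisymm (closure_subset_closure_iff.1 h.subset) (closure_subset_closure_iff.1 h.symm.subset)

end RegularOpens

/-! ### Existence of a completion: regular open sets of the dual space. -/

namespace LocalContactAlgebra

open RegularOpens

variable {A : Type u} [BooleanAlgebra A] (L : LocalContactAlgebra A)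

/-- The representing regular open set of an element: the interior of the basic closed set. -/
def basicRegularOpen (a : A) : RegularOpens L.DualSpace :=
  ofIsClosed (L.basicClosed a) (isClosed_basicClosed a)

theorem carrier_basicRegularOpen (a : A) :
    (L.basicRegularOpen a).carrier = (L.basicClosed aᶜ)ᶜ :=
  interior_basicClosed a

theorem closure_carrier_basicRegularOpen (a : A) :
    closure (L.basicRegularOpen a).carrier = L.basicClosed a := by
  rw [carrier_basicRegularOpen, closure_compl_basicClosed_compl]

/-- The representation of an LCA in the regular open sets of its dual space. -/
def representation : BoundedLatticeHom A (RegularOpens L.DualSpace) where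
  toFun := L.basicRegularOpen
  map_sup' a b := closure_carrier_injective <| by
    simp only [closure_carrier_sup, closure_carrier_basicRegularOpen, basicClosed_sup]
  map_inf' a b := carrier_injective <| by
    simp only [carrier_inf, carrier_basicRegularOpen, compl_inf, basicClosed_sup,
      Set.compl_union]
  map_top' := carrier_injective <| by
    simp only [carrier_top, carrier_basicRegularOpen, compl_top, basicClosed_bot,
      Set.compl_empty]
  map_bot' := closure_carrier_injective <| by
    simp only [closure_carrier_bot, closure_carrier_basicRegularOpen, basicClosed_bot]

theorem carrier_representation (a : A) :
    (L.representation a).carrier = (L.basicClosed aᶜ)ᶜ :=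
  L.carrier_basicRegularOpen a

theorem closure_carrier_representation (a : A) :
    closure (L.representation a).carrier = L.basicClosed a :=
  L.closure_carrier_basicRegularOpen a

theorem isCompletion_representation :
    L.IsCompletion (localContactAlgebra L.DualSpace) L.representation where
  isEmbedding :=
    { injective := fun a b h => by
        have h' : L.basicClosed a = L.basicClosed b := by
          rw [← L.closure_carrier_representation, h, L.closure_carrier_representation]
        exact le_antisymm (basicClosed_subset_iff.1 h'.subset)
          (basicClosed_subset_iff.1 h'.symm.subset)
      rel_iff := fun a b => by
        rw [← basicClosed_inter_nonempty_iff (L := L), ← L.closure_carrier_representation,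
          ← L.closure_carrier_representation]
        rfl
      mem_bdd_iff := fun a => by
        rw [← isCompact_basicClosed_iff (L := L), ← L.closure_carrier_representation]
        rfl }
  isDVDense := by
    have hbdd : ∀ a, L.representation a ∈ (localContactAlgebra L.DualSpace).bdd ↔ a ∈ L.bdd :=
      fun a => by
        rw [← isCompact_basicClosed_iff (L := L), ← L.closure_carrier_representation]
        rfl
    refine ⟨?_, fun U hU V hV h => ?_⟩
    · rintro _ ⟨a, ha, rfl⟩
      exact (hbdd a).2 ha
    -- The compact closure of U is covered by basic open subsets of V. Each is the carrier of the
    -- image of some bᶜ, and a finite join of such elements serves as a; it is bounded because its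
    -- image lies below V.
    obtain ⟨a, h₁, h₂⟩ : ∃ a : A, closure U.carrier ⊆ (L.representation a).carrier ∧
        L.representation a ≤ V := by
      have hUV : closure U.carrier ⊆ V.carrier := wayInside_iff.1 h
      have hc : IsCompact (closure U.carrier) := hU
      refine hc.induction_on (p := fun s => ∃ a : A, s ⊆ (L.representation a).carrier ∧
        L.representation a ≤ V) ⟨⊥, Set.empty_subset _, by rw [map_bot]; exact bot_le⟩
        (fun s t hst ⟨a, h⟩ => ⟨a, hst.trans h.1, h.2⟩)
        (fun s t ⟨a, h⟩ ⟨b, h'⟩ => ⟨a ⊔ b, Set.union_subset ?_ ?_, ?_⟩) fun σ hσ => ?_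
      · exact h.1.trans (le_iff.1 (by rw [map_sup]; exact le_sup_left))
      · exact h'.1.trans (le_iff.1 (by rw [map_sup]; exact le_sup_right))
      · rw [map_sup]
        exact sup_le h.2 h'.2
      · obtain ⟨_, ⟨b, rfl⟩, hb, hbV⟩ :=
          isTopologicalBasis_compl_basicClosed.exists_subset_of_mem_open (hUV hσ)
            V.isOpen_carrier
        have hcar := L.carrier_representation bᶜ
        rw [compl_compl] at hcar
        refine ⟨(L.basicClosed b)ᶜ, mem_nhdsWithin_of_mem_nhds
          ((isClosed_basicClosed b).isOpen_compl.mem_nhds hb), bᶜ, hcar.symm.subset, ?_⟩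
        rw [le_iff, hcar]
        exact hbV
    exact ⟨_, ⟨a, (hbdd a).1 ((localContactAlgebra _).bdd.lower h₂ hV), rfl⟩,
      le_iff.2 (subset_closure.trans h₁), h₂⟩

end LocalContactAlgebra

/-! ### Uniqueness of order-dense complete extensions of a Boolean algebra. -/

section OrderDense

variable {A : Type u} {B₁ : Type v} {B₂ : Type w} [BooleanAlgebra A]

/-- A homomorphism of Boolean algebras has order-dense image if there is a nonzero element of its
image below each nonzero element. -/
def HasOrderDenseImage [BooleanAlgebra B₁] (φ : BoundedLatticeHom A B₁) : Prop :=
  ∀ y : B₁, y ≠ ⊥ → ∃ a, φ a ≠ ⊥ ∧ φ a ≤ y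

theorem HasOrderDenseImage.le_iff [BooleanAlgebra B₁] {φ : BoundedLatticeHom A B₁}
    (h : HasOrderDenseImage φ) {x y : B₁} : x ≤ y ↔ ∀ a, φ a ≤ x → φ a ≤ y := by
  refine ⟨fun hxy a ha => ha.trans hxy, fun hxy => ?_⟩
  by_contra hne
  obtain ⟨a, ha, hle⟩ := h (x ⊓ yᶜ) fun h0 => hne (by
    rwa [← disjoint_compl_right_iff, disjoint_iff])
  have := le_inf (hxy a (hle.trans inf_le_left)) (hle.trans inf_le_right)
  exact ha (le_bot_iff.1 (by rwa [inf_compl_eq_bot] at this))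

/-- The dual form of density, obtained by complementing: x is determined from above by the image
elements that bound it. -/
theorem HasOrderDenseImage.image_le_of_forall [BooleanAlgebra B₁] {φ : BoundedLatticeHom A B₁}
    (h : HasOrderDenseImage φ) {b : A} {x : B₁} (hx : ∀ c, x ≤ φ c → φ b ≤ φ c) : φ b ≤ x := by
  by_contra hne
  obtain ⟨a, ha, hle⟩ := h (φ b ⊓ xᶜ) fun h0 => hne (by
    rwa [← disjoint_compl_right_iff, disjoint_iff])
  have h₁ : φ b ≤ φ aᶜ := hx _ (by
    rw [map_compl']; exact le_compl_comm.1 (hle.trans inf_le_right))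
  have h₂ := le_inf le_rfl ((hle.trans inf_le_left).trans h₁)
  rw [← map_inf, inf_compl_eq_bot, map_bot] at h₂
  exact ha (le_bot_iff.1 h₂)

theorem BoundedLatticeHom.le_iff_of_injective [BooleanAlgebra B₁] {φ : BoundedLatticeHom A B₁}
    (h : Function.Injective φ) {a b : A} : φ a ≤ φ b ↔ a ≤ b := by
  rw [← inf_eq_left, ← map_inf, h.eq_iff, inf_eq_left]

variable [CompleteBooleanAlgebra B₁] [CompleteBooleanAlgebra B₂]

/-- Taking the supremum adds no new image elements below it: if x ≤ φ₁ c, then φ₂ c bounds the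
supremum, so b ≤ c, and such c determine x from above. -/
theorem HasOrderDenseImage.le_sSup_iff {φ₁ : BoundedLatticeHom A B₁}
    {φ₂ : BoundedLatticeHom A B₂} (i₁ : Function.Injective φ₁) (h₁ : HasOrderDenseImage φ₁)
    (i₂ : Function.Injective φ₂) {b : A} {x : B₁} :
    φ₂ b ≤ sSup (φ₂ '' {a | φ₁ a ≤ x}) ↔ φ₁ b ≤ x := by
  refine ⟨fun h => h₁.image_le_of_forall fun c hc => ?_, fun h => le_sSup ⟨b, h, rfl⟩⟩
  rw [BoundedLatticeHom.le_iff_of_injective i₁, ← BoundedLatticeHom.le_iff_of_injective i₂]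
  refine h.trans (sSup_le ?_)
  rintro _ ⟨a, ha, rfl⟩
  rw [BoundedLatticeHom.le_iff_of_injective i₂, ← BoundedLatticeHom.le_iff_of_injective i₁]
  exact ha.trans hc

/-- Complete Boolean algebras that contain the same Boolean algebra order-densely are
isomorphic. -/
def HasOrderDenseImage.orderIso {φ₁ : BoundedLatticeHom A B₁}
    {φ₂ : BoundedLatticeHom A B₂} (i₁ : Function.Injective φ₁) (h₁ : HasOrderDenseImage φ₁)
    (i₂ : Function.Injective φ₂) (h₂ : HasOrderDenseImage φ₂) : B₁ ≃o B₂ where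
  toFun x := sSup (φ₂ '' {a | φ₁ a ≤ x})
  invFun y := sSup (φ₁ '' {a | φ₂ a ≤ y})
  left_inv x := le_antisymm
    (h₁.le_iff.2 fun a ha => (h₁.le_sSup_iff i₁ i₂).1 ((h₂.le_sSup_iff i₂ i₁).1 ha))
    (h₁.le_iff.2 fun a ha => (h₂.le_sSup_iff i₂ i₁).2 ((h₁.le_sSup_iff i₁ i₂).2 ha))
  right_inv x := le_antisymm
    (h₂.le_iff.2 fun a ha => (h₂.le_sSup_iff i₂ i₁).1 ((h₁.le_sSup_iff i₁ i₂).1 ha))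
    (h₂.le_iff.2 fun a ha => (h₁.le_sSup_iff i₁ i₂).2 ((h₂.le_sSup_iff i₂ i₁).2 ha))
  map_rel_iff' {x y} := by
    simp only [Equiv.coe_fn_mk]
    rw [h₂.le_iff, h₁.le_iff]
    exact forall_congr' fun a => by rw [h₁.le_sSup_iff i₁ i₂, h₁.le_sSup_iff i₁ i₂]

theorem HasOrderDenseImage.orderIso_apply {φ₁ : BoundedLatticeHom A B₁}
    {φ₂ : BoundedLatticeHom A B₂} (i₁ : Function.Injective φ₁) (h₁ : HasOrderDenseImage φ₁)
    (i₂ : Function.Injective φ₂) (h₂ : HasOrderDenseImage φ₂) (a : A) :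
    h₁.orderIso i₁ i₂ h₂ (φ₁ a) = φ₂ a := by
  refine le_antisymm (h₂.le_iff.2 fun b hb => ?_) (le_sSup ⟨a, le_rfl, rfl⟩)
  have := (h₁.le_sSup_iff i₁ i₂).1 hb
  rwa [BoundedLatticeHom.le_iff_of_injective i₁, ← BoundedLatticeHom.le_iff_of_injective i₂]
    at this

end OrderDense

/-! ### Contact and boundedness in a completion are determined by the embedded LCA. -/

namespace LocalContactAlgebra.IsCompletion

variable {A : Type u} {B : Type v} [BooleanAlgebra A] [CompleteBooleanAlgebra B]
  {L : LocalContactAlgebra A} {M : LocalContactAlgebra B} {φ : BoundedLatticeHom A B}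

theorem exists_between (h : L.IsCompletion M φ) {x y : B} (hx : x ∈ M.bdd) (hy : y ∈ M.bdd)
    (hxy : WayInside M.rel x y) : ∃ a ∈ L.bdd, x ≤ φ a ∧ φ a ≤ y := by
  obtain ⟨_, ⟨a, ha, rfl⟩, h'⟩ := h.isDVDense.2 x hx y hy hxy
  exact ⟨a, ha, h'⟩

theorem hasOrderDenseImage (h : L.IsCompletion M φ) : HasOrderDenseImage φ := by
  intro y hy
  obtain ⟨b, hb, hb0, hby⟩ := M.exists_inside y hy
  -- Since y may be unbounded, a bounded c is inserted before dV-density is applied.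
  obtain ⟨c, hc, hbc, hcy⟩ := M.interpolate b hb y hby
  obtain ⟨a, -, hba, hac⟩ := h.exists_between hb hc hbc
  exact ⟨a, fun h0 => hb0 (le_bot_iff.1 (h0 ▸ hba)),
    hac.trans (M.isContact.le_of_wayInside hcy)⟩

theorem mem_bdd_iff (h : L.IsCompletion M φ) {x : B} : x ∈ M.bdd ↔ ∃ a ∈ L.bdd, x ≤ φ a := by
  refine ⟨fun hx => ?_, fun ⟨a, ha, hxa⟩ =>
    M.bdd.lower hxa ((h.isEmbedding.mem_bdd_iff a).2 ha)⟩
  obtain ⟨y, hy, hxy⟩ := M.exists_wayInside_of_mem_bdd hx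
  obtain ⟨a, ha, hxa, -⟩ := h.exists_between hx hy hxy
  exact ⟨a, ha, hxa⟩

/-- In a chain x ≪ z₁ ≪ z₂ ≪ z₃ ≪ yᶜ, density gives x ≤ φ a ≤ z₁ and z₂ ≤ φ b ≤ z₃; the middle gap
makes φ a ≪ φ b, so a and bᶜ separate. -/
theorem not_rel_iff_of_mem_bdd (h : L.IsCompletion M φ) {x y : B} (hx : x ∈ M.bdd) :
    ¬ M.rel x y ↔ ∃ a b, x ≤ φ a ∧ y ≤ φ b ∧ ¬ L.rel a b := by
  refine ⟨fun hxy => ?_, fun ⟨a, b, hxa, hyb, hab⟩ hxy =>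
    hab ((h.isEmbedding.rel_iff a b).1 (M.isContact.mono hxy hxa hyb))⟩
  obtain ⟨z₁, hz₁, h₁, hxy₁⟩ := M.interpolate x hx yᶜ (by rwa [WayInside, compl_compl])
  obtain ⟨z₂, hz₂, h₂, hxy₂⟩ := M.interpolate z₁ hz₁ yᶜ hxy₁
  obtain ⟨z₃, hz₃, h₃, hxy₃⟩ := M.interpolate z₂ hz₂ yᶜ hxy₂
  obtain ⟨a, -, hxa, ha⟩ := h.exists_between hx hz₁ h₁
  obtain ⟨b, -, hb, hb'⟩ := h.exists_between hz₂ hz₃ h₃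
  refine ⟨a, bᶜ, hxa, ?_, ?_⟩
  · rw [map_compl', le_compl_comm]
    exact hb'.trans (M.isContact.le_of_wayInside hxy₃)
  · rw [← h.isEmbedding.rel_iff, map_compl']
    exact M.isContact.wayInside_mono h₂ ha hb

theorem rel_iff_exists (h : L.IsCompletion M φ) {x y : B} :
    M.rel x y ↔ ∃ c ∈ L.bdd, M.rel (φ c ⊓ x) y := by
  refine ⟨fun hxy => ?_, fun ⟨c, _, hc⟩ => M.isContact.mono hc inf_le_right le_rfl⟩
  obtain ⟨d, hd, h'⟩ := M.rel_local y x (M.isContact.symm _ _ hxy)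
  obtain ⟨c, hc, hdc⟩ := h.mem_bdd_iff.1 hd
  exact ⟨c, hc, M.isContact.mono (M.isContact.symm _ _ h') (inf_le_inf_right _ hdc) le_rfl⟩

/-- The right-hand side involves only L, φ and the lattice structure of B, so it is carried along
any order isomorphism commuting with the embeddings. -/
theorem rel_iff (h : L.IsCompletion M φ) {x y : B} :
    M.rel x y ↔ ∃ c ∈ L.bdd, ∀ a b, φ c ⊓ x ≤ φ a → y ≤ φ b → L.rel a b := by
  rw [h.rel_iff_exists]
  refine exists_congr fun c => and_congr_right fun hc => ?_
  rw [← not_iff_not, h.not_rel_iff_of_mem_bdd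
    (M.bdd.lower inf_le_left ((h.isEmbedding.mem_bdd_iff c).2 hc))]
  push Not
  rfl

theorem id {M : LocalContactAlgebra B} : M.IsCompletion M (BoundedLatticeHom.id B) where
  isEmbedding := ⟨Function.injective_id, fun _ _ => Iff.rfl, fun _ => Iff.rfl⟩
  isDVDense := ⟨by rintro _ ⟨a, ha, rfl⟩; exact ha, fun a ha c _ h =>
    ⟨a, ⟨a, ha, rfl⟩, le_rfl, M.isContact.le_of_wayInside h⟩⟩

theorem comp_isIso (h : L.IsCompletion M φ) {B' : Type w} [CompleteBooleanAlgebra B']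
    {N : LocalContactAlgebra B'} {η : B ≃o B'} (hη : M.IsIso N η) :
    L.IsCompletion N ((η : BoundedLatticeHom B B').comp φ) where
  isEmbedding :=
    { injective := η.injective.comp h.isEmbedding.injective
      rel_iff := fun a b => (hη.rel_iff _ _).trans (h.isEmbedding.rel_iff a b)
      mem_bdd_iff := fun a => (hη.mem_bdd_iff _).trans (h.isEmbedding.mem_bdd_iff a) }
  isDVDense := by
    refine ⟨?_, fun x hx y hy hxy => ?_⟩
    · rintro _ ⟨a, ha, rfl⟩
      exact (hη.mem_bdd_iff _).2 ((h.isEmbedding.mem_bdd_iff a).2 ha)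
    obtain ⟨x, rfl⟩ := η.surjective x
    obtain ⟨y, rfl⟩ := η.surjective y
    rw [hη.mem_bdd_iff] at hx hy
    obtain ⟨a, ha, h₁, h₂⟩ := h.exists_between hx hy
      (by rwa [WayInside, ← map_compl', hη.rel_iff] at hxy)
    exact ⟨_, ⟨a, ha, rfl⟩, η.monotone h₁, η.monotone h₂⟩

/-- Any two completions of a local contact algebra are equivalent. -/
theorem exists_isIso {B₂ : Type w} [CompleteBooleanAlgebra B₂] {M₂ : LocalContactAlgebra B₂}
    {φ₂ : BoundedLatticeHom A B₂} (h : L.IsCompletion M φ) (h₂ : L.IsCompletion M₂ φ₂) :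
    ∃ η : B ≃o B₂, M.IsIso M₂ η ∧ ∀ a : A, φ₂ a = η (φ a) := by
  let η : B ≃o B₂ := h.hasOrderDenseImage.orderIso h.isEmbedding.injective
    h₂.isEmbedding.injective h₂.hasOrderDenseImage
  have hη : ∀ a, η (φ a) = φ₂ a := HasOrderDenseImage.orderIso_apply _ _ _ _
  refine ⟨η, ⟨fun x y => ?_, fun x => ?_⟩, fun a => (hη a).symm⟩
  · simp only [h.rel_iff, h₂.rel_iff, ← hη, ← map_inf, η.le_iff_le]
  · simp only [h.mem_bdd_iff, h₂.mem_bdd_iff, ← hη, η.le_iff_le]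

end LocalContactAlgebra.IsCompletion

/-! ### Recovering a locally compact Hausdorff space from an LCA completed by its regular open sets.
-/

open RegularOpens

namespace LocalContactAlgebra.IsCompletion

variable {A : Type u} [BooleanAlgebra A] {L : LocalContactAlgebra A} {X : Type v}
  [TopologicalSpace X] [LocallyCompactSpace X] [T2Space X]
  {φ : BoundedLatticeHom A (RegularOpens X)}

theorem exists_mem_carrier_closure_subset (h : L.IsCompletion (localContactAlgebra X) φ) {x : X}
    {O : Set X} (hO : IsOpen O) (hx : x ∈ O) :
    ∃ a ∈ L.bdd, x ∈ (φ a).carrier ∧ closure (φ a).carrier ⊆ O := by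
  obtain ⟨V, hV, hxV, hVO⟩ := RegularOpens.exists_between (isCompact_singleton (x := x)) hO
    (Set.singleton_subset_iff.2 hx)
  obtain ⟨W, hW, hxW, hWV⟩ := RegularOpens.exists_between (isCompact_singleton (x := x))
    V.isOpen_carrier hxV
  obtain ⟨a, ha, hWa, haV⟩ := h.exists_between hW hV (wayInside_iff.2 hWV)
  exact ⟨a, ha, hWa (hxW rfl), (closure_mono haV).trans hVO⟩

/-- The bounded cluster of all elements whose representing set has a given point in its
closure. -/
def pointCluster (h : L.IsCompletion (localContactAlgebra X) φ) (x : X) : L.DualSpace :=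
  ⟨{a | x ∈ closure (φ a).carrier},
    { nonempty := ⟨⊤, by
        rw [Set.mem_ofPred_eq, map_top, carrier_top, closure_univ]
        exact Set.mem_univ x⟩
      rel_of_mem := fun a ha b hb => Or.inl ((h.isEmbedding.rel_iff a b).1 ⟨x, ha, hb⟩)
      mem_or_mem := fun a b hab => by
        rwa [Set.mem_ofPred_eq, map_sup, closure_carrier_sup] at hab
      mem_of_forall_rel := fun a ha => by
        by_contra hx
        -- Boundedness of b excludes the second alternative of `alexandroffRel`, leaving genuine
        -- contact with a, which the choice of b forbids.
        obtain ⟨b, hb, hxb, hba⟩ := h.exists_mem_carrier_closure_subset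
          isClosed_closure.isOpen_compl hx
        have hr := ha b (subset_closure hxb)
        rw [alexandroffRel, or_iff_left (fun h' => h'.2 hb), ← h.isEmbedding.rel_iff] at hr
        obtain ⟨y, hya, hyb⟩ := hr
        exact hba hyb hya },
    by
      obtain ⟨b, hb, hxb, -⟩ := h.exists_mem_carrier_closure_subset isOpen_univ
        (Set.mem_univ x)
      exact ⟨b, subset_closure hxb, hb⟩⟩

theorem mem_pointCluster (h : L.IsCompletion (localContactAlgebra X) φ) {x : X} {a : A} :
    a ∈ (h.pointCluster x).1 ↔ x ∈ closure (φ a).carrier := Iff.rfl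

theorem pointCluster_injective (h : L.IsCompletion (localContactAlgebra X) φ) :
    Function.Injective h.pointCluster := by
  intro x y hxy
  by_contra hne
  obtain ⟨a, -, hxa, hay⟩ := h.exists_mem_carrier_closure_subset
    (isClosed_singleton (x := y)).isOpen_compl hne
  exact hay (h.mem_pointCluster.1 (hxy ▸ h.mem_pointCluster.2 (subset_closure hxa))) rfl

/-- Otherwise every x has a neighbourhood φ d with d ∉ σ. By compactness finitely many cover φ a₀
for a bounded a₀ ∈ σ, and by (K2) their join is still outside σ although it lies above a₀. -/
theorem pointCluster_surjective (h : L.IsCompletion (localContactAlgebra X) φ) :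
    Function.Surjective h.pointCluster := by
  intro σ
  obtain ⟨a₀, ha₀σ, ha₀⟩ := σ.2.2
  have hK : IsCompact (closure (φ a₀).carrier) := (h.isEmbedding.mem_bdd_iff a₀).2 ha₀
  obtain ⟨x, hx⟩ : ∃ x, σ.1 ⊆ (h.pointCluster x).1 := by
    by_contra! hno
    obtain ⟨d, hd, hKd⟩ : ∃ d ∉ σ.1, closure (φ a₀).carrier ⊆ closure (φ d).carrier := by
      refine hK.induction_on (p := fun s => ∃ d ∉ σ.1, s ⊆ closure (φ d).carrier)
        ⟨⊥, σ.isCluster.bot_notMem L.isContact_alexandroffRel, Set.empty_subset _⟩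
        (fun s t hst ⟨d, hd, h⟩ => ⟨d, hd, hst.trans h⟩)
        (fun s t ⟨d, hd, h₁⟩ ⟨e, he, h₂⟩ => ⟨d ⊔ e,
          fun h' => (σ.isCluster.mem_or_mem _ _ h').elim hd he, ?_⟩) fun x _ => ?_
      · rw [map_sup, closure_carrier_sup]
        exact Set.union_subset_union h₁ h₂
      · obtain ⟨b, hbσ, hbx⟩ := Set.not_subset.1 (hno x)
        obtain ⟨d, hd, hxd, hdb⟩ := h.exists_mem_carrier_closure_subset
          isClosed_closure.isOpen_compl hbx
        refine ⟨_, mem_nhdsWithin_of_mem_nhds ((φ d).isOpen_carrier.mem_nhds hxd), d,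
          fun hdσ => ?_, subset_closure⟩
        obtain ⟨y, hyd, hyb⟩ := (h.isEmbedding.rel_iff d b).2 (σ.rel_of_mem hdσ hbσ)
        exact hdb hyd hyb
    refine hd (σ.mem_of_le ha₀σ ?_)
    rw [← BoundedLatticeHom.le_iff_of_injective h.isEmbedding.injective]
    exact closure_subset_closure_iff.1 hKd
  exact ⟨x, Subtype.ext (σ.isCluster.eq_of_subset (h.pointCluster x).isCluster hx).symm⟩

/-- A locally compact Hausdorff space is the dual space of each local contact algebra that has
the regular open sets of the space as a completion. -/
theorem nonempty_homeomorph (h : L.IsCompletion (localContactAlgebra X) φ) :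
    Nonempty (X ≃ₜ L.DualSpace) := by
  refine ⟨(Equiv.ofBijective _ ⟨h.pointCluster_injective,
    h.pointCluster_surjective⟩).toHomeomorphOfContinuousOpen ?_ ?_⟩
  · refine continuous_generateFrom_iff.2 ?_
    rintro _ ⟨a, rfl⟩
    exact (isClosed_closure (s := (φ a).carrier)).isOpen_compl
  · intro O hO
    refine isOpen_iff_mem_nhds.2 ?_
    rintro _ ⟨x, hx, rfl⟩
    obtain ⟨a, -, hxa, haO⟩ := h.exists_mem_carrier_closure_subset hO hx
    refine Filter.mem_of_superset ((isClosed_basicClosed aᶜ).isOpen_compl.mem_nhds ?_) ?_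
    · change ¬ x ∈ closure (φ aᶜ).carrier
      rw [map_compl', closure_carrier_compl]
      exact fun h' => h' hxa
    · intro σ hσ
      obtain ⟨y, rfl⟩ := h.pointCluster_surjective σ
      refine ⟨y, haO (subset_closure ?_), rfl⟩
      by_contra hy
      refine hσ ?_
      change y ∈ closure (φ aᶜ).carrier
      rwa [map_compl', closure_carrier_compl]

end LocalContactAlgebra.IsCompletion

/-! ### Transport of regular open sets along homeomorphisms. -/

namespace RegularOpens

variable {X : Type u} {Y : Type v} [TopologicalSpace X] [TopologicalSpace Y]

/-- The image of a regular open set under a homeomorphism. -/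
def map (h : X ≃ₜ Y) (U : RegularOpens X) : RegularOpens Y :=
  ofIsClosed (h '' closure U.carrier) (h.isClosed_image.2 isClosed_closure)

theorem carrier_map (h : X ≃ₜ Y) (U : RegularOpens X) :
    (U.map h).carrier = h '' U.carrier := by
  rw [map, carrier_ofIsClosed, ← h.image_interior, interior_closure_carrier]

/-- Homeomorphic spaces have isomorphic algebras of regular open sets. -/
def congr (h : X ≃ₜ Y) : RegularOpens X ≃o RegularOpens Y where
  toFun := map h
  invFun := map h.symm
  left_inv U := carrier_injective <| by
    rw [carrier_map, carrier_map, ← Set.image_comp, h.symm_comp_self, Set.image_id]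
  right_inv U := carrier_injective <| by
    rw [carrier_map, carrier_map, ← Set.image_comp, h.self_comp_symm, Set.image_id]
  map_rel_iff' {U V} := by
    rw [Equiv.coe_fn_mk, le_iff, le_iff, carrier_map, carrier_map,
      Set.image_subset_image_iff h.injective]

theorem closure_carrier_congr (h : X ≃ₜ Y) (U : RegularOpens X) :
    closure (congr h U).carrier = h '' closure U.carrier := by
  rw [h.image_closure]
  exact congrArg closure (carrier_map h U)

theorem isIso_congr [LocallyCompactSpace X] [RegularSpace X] [LocallyCompactSpace Y]
    [RegularSpace Y] (h : X ≃ₜ Y) :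
    (localContactAlgebra X).IsIso (localContactAlgebra Y) (congr h) where
  rel_iff U V := by
    change (closure (congr h U).carrier ∩ closure (congr h V).carrier).Nonempty ↔
      (closure U.carrier ∩ closure V.carrier).Nonempty
    rw [closure_carrier_congr, closure_carrier_congr, ← Set.image_inter h.injective,
      Set.image_nonempty]
  mem_bdd_iff U := by
    change IsCompact (closure (congr h U).carrier) ↔ IsCompact (closure U.carrier)
    rw [closure_carrier_congr, h.isCompact_image]

end RegularOpens

/-! ### Homeomorphic dual spaces and common completions. -/

namespace LocalContactAlgebra

variable {A : Type u} [BooleanAlgebra A] {L : LocalContactAlgebra A}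

theorem nonempty_homeomorph_iff_exists_isCompletion {B : Type v} [CompleteBooleanAlgebra B]
    {M : LocalContactAlgebra B} :
    Nonempty (L.DualSpace ≃ₜ M.DualSpace) ↔ ∃ φ : BoundedLatticeHom A B, L.IsCompletion M φ := by
  -- M and the regular open sets of its dual space both complete M; η and ζ are the resulting
  -- isomorphisms in the two directions.
  obtain ⟨η, hη, -⟩ := M.isCompletion_representation.exists_isIso IsCompletion.id
  obtain ⟨ζ, hζ, -⟩ := IsCompletion.id.exists_isIso M.isCompletion_representation
  refine ⟨fun ⟨h⟩ => ⟨_, (L.isCompletion_representation.comp_isIso (isIso_congr h)).comp_isIso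
    hη⟩, fun ⟨φ, hφ⟩ => ?_⟩
  obtain ⟨h⟩ := (hφ.comp_isIso hζ).nonempty_homeomorph
  exact ⟨h.symm⟩

end LocalContactAlgebra

theorem theorem7p2 {A : Type u} [BooleanAlgebra A] (L : LocalContactAlgebra A) :
    -- existence of an LCA-completion
    (∃ (B : Type u) (_ : CompleteBooleanAlgebra B) (M : LocalContactAlgebra B)
      (φ : BoundedLatticeHom A B), L.IsCompletion M φ) ∧
    -- uniqueness up to equivalence
    (∀ (B₁ : Type v) [CompleteBooleanAlgebra B₁] (M₁ : LocalContactAlgebra B₁)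
      (φ₁ : BoundedLatticeHom A B₁)
      (B₂ : Type w) [CompleteBooleanAlgebra B₂] (M₂ : LocalContactAlgebra B₂)
      (φ₂ : BoundedLatticeHom A B₂),
      L.IsCompletion M₁ φ₁ → L.IsCompletion M₂ φ₂ →
      ∃ η : B₁ ≃o B₂, M₁.IsIso M₂ η ∧ ∀ a : A, φ₂ a = η (φ₁ a)) ∧
    -- an LCA and a complete LCA with homeomorphic dual spaces
    (∀ (B : Type v) [CompleteBooleanAlgebra B] (M : LocalContactAlgebra B),
      Nonempty (L.DualSpace ≃ₜ M.DualSpace) ↔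
        ∃ φ : BoundedLatticeHom A B,
          L.IsEmbedding M φ ∧ M.IsDVDense (φ '' (L.bdd : Set A))) ∧
    -- two LCAs with homeomorphic dual spaces
    (∀ (A' : Type v) [BooleanAlgebra A'] (L' : LocalContactAlgebra A'),
      Nonempty (L.DualSpace ≃ₜ L'.DualSpace) ↔
        ∃ (B : Type u) (_ : CompleteBooleanAlgebra B) (M : LocalContactAlgebra B)
          (φ : BoundedLatticeHom A B) (φ' : BoundedLatticeHom A' B),
          L.IsEmbedding M φ ∧ L'.IsEmbedding M φ' ∧
          M.IsDVDense (φ '' (L.bdd : Set A)) ∧ M.IsDVDense (φ' '' (L'.bdd : Set A'))) := by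

  refine ⟨⟨_, _, _, _, L.isCompletion_representation⟩,
    fun B₁ _ M₁ φ₁ B₂ _ M₂ φ₂ h₁ h₂ => h₁.exists_isIso h₂, fun B _ M => ?_, fun A' _ L' => ?_⟩
  · exact LocalContactAlgebra.nonempty_homeomorph_iff_exists_isCompletion.trans
      (exists_congr fun φ => ⟨fun h => ⟨h.1, h.2⟩, fun h => ⟨h.1, h.2⟩⟩)
  · refine ⟨fun ⟨h⟩ => ?_, ?_⟩
    · have h₁ := L.isCompletion_representation
      have h₂ := L'.isCompletion_representation.comp_isIso (RegularOpens.isIso_congr h.symm)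
      -- The common completion consists of the regular open sets of the dual space of L.
      exact ⟨_, _, _, _, _, h₁.1, h₂.1, h₁.2, h₂.2⟩
    · rintro ⟨B, _, M, φ, φ', h₁, h₂, h₃, h₄⟩
      obtain ⟨h⟩ := LocalContactAlgebra.nonempty_homeomorph_iff_exists_isCompletion.2
        ⟨φ, LocalContactAlgebra.IsCompletion.mk h₁ h₃⟩
      obtain ⟨h'⟩ := LocalContactAlgebra.nonempty_homeomorph_iff_exists_isCompletion.2
        ⟨φ', LocalContactAlgebra.IsCompletion.mk h₂ h₄⟩
      exact ⟨h.trans h'.symm⟩
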